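/- Let $r\in\mathbb N$, $p\in[1,\infty)$, and let $q\in L_p((-1,1),M_r)$, where $M_n$ denotes the $n\times n$ complex matrices. Write $I=I_r$ and put $$J=\frac1{i}\begin{pmatrix}I&0\\0&-I\end{pmatrix},\quad Q=\begin{pmatrix}0&q\\q^*&0\end{pmatrix},\quad P_1=\begin{pmatrix}I&0\\0&0\end{pmatrix},\quad P_2=\begin{pmatrix}0&0\\0&I\end{pmatrix}.$$ Let $\mathcal H=L_2((-1,1),\mathbb C^{2r})$. For $s\ge1$, let $W_s^1((-1,1),\mathbb C^{2r})$ be the Sobolev space of absolutely continuous functions on $[-1,1]$ with derivative in $L_s$. The maximal operator $T_q$ in $\mathcal H$ is given by $T_qy=Jy'+Qy$ on the domain $$D(T_q)=\{y\in W^1_{\min\{p,2\}}((-1,1),\mathbb C^{2r})\mid Jy'+Qy\in\mathcal H\},$$ and the minimal operator is its adjoint, $T_q^0=T_q^*$. For a unitary matrix $U\in\mathcal U_{2r}$ set $A_U=P_2+UP_1$, $B_U=P_1+UP_2$, and let $T_{q,U}$ be the restriction of $T_q$ to the domain $\{y\in D(T_q)\mid A_Uy(-1)+B_Uy(1)=0\}$.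 Then a linear operator $T$ in $\mathcal H$ is a self-adjoint extension of $T_q^0$ if and only if $T=T_{q,U}$ for some $U\in\mathcal U_{2r}$, and $T_{q,U}=T_{q,V}$ only if $U=V$. That is, $U\mapsto T_{q,U}$ is a bijection from $\mathcal U_{2r}$ onto the set of self-adjoint extensions of $T_q^0$. -/

import Mathlib

open MeasureTheory Set

open scoped ENNReal Matrix InnerProductSpace

namespace Dirac

noncomputable section

/-- The space `ℂ^{2r}`, written as `ℂ^r ⊕ ℂ^r`, with its Euclidean norm. -/
abbrev C2 (r : ℕ) : Type := EuclideanSpace ℂ (Fin r ⊕ Fin r)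

/-- The set `M_{2r}` of `2r × 2r` complex matrices, seen as `2 × 2` block matrices with
`r × r` blocks. -/
abbrev M2 (r : ℕ) : Type := Matrix (Fin r ⊕ Fin r) (Fin r ⊕ Fin r) ℂ

/-- Lebesgue measure on the interval `(-1, 1)`. -/
def mu : Measure ℝ := volume.restrict (Ioo (-1) 1)

/-- The Hilbert space `L_2((-1,1), ℂ^{2r})`. -/
abbrev H (r : ℕ) : Type := Lp (C2 r) 2 mu

/-- Membership in `L_p((-1,1), M_r)`: all entries belong to `L_p(-1,1)`. -/
def MemQ {r : ℕ} (p : ℝ≥0∞) (q : ℝ → Matrix (Fin r) (Fin r) ℂ) : Prop :=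
  ∀ i j, MemLp (fun x => q x i j) p mu

/-- The matrix `J = (1/i) diag(I, -I)`. -/
def J (r : ℕ) : M2 r := (1 / Complex.I) • Matrix.fromBlocks 1 0 0 (-1)

/-- The potential `Q = (0, q; q^*, 0)`. -/
def Q {r : ℕ} (q : ℝ → Matrix (Fin r) (Fin r) ℂ) (x : ℝ) : M2 r :=
  Matrix.fromBlocks 0 (q x) (q x)ᴴ 0

/-- `y` is the absolutely continuous representative, on `[-1,1]`, of an element of the Sobolev
space `W_s^1((-1,1), ℂ^{2r})`, and `g ∈ L_s` is its derivative (`1 ≤ s`). -/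
def IsSobolev {r : ℕ} (s : ℝ≥0∞) (y g : ℝ → C2 r) : Prop :=
  MemLp g s mu ∧ ∀ x ∈ Icc (-1 : ℝ) 1, y x = y (-1) + ∫ t in (-1 : ℝ)..x, g t

theorem IsSobolev.intervalIntegrable {r : ℕ} {s : ℝ≥0∞} (hs : 1 ≤ s) {g : ℝ → C2 r}
    (h : MemLp g s mu) {x : ℝ} (hx : x ∈ Icc (-1 : ℝ) 1) :
    IntervalIntegrable g volume (-1) x := by
  have : IsFiniteMeasure mu := by unfold mu; infer_instance
  have h1 : IntegrableOn g (Ioo (-1) 1) volume := (h.integrable hs :)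
  rw [intervalIntegrable_iff_integrableOn_Ioo_of_le hx.1]
  exact h1.mono_set (Ioo_subset_Ioo_right hx.2)

theorem IsSobolev.add {r : ℕ} {s : ℝ≥0∞} (hs : 1 ≤ s) {y g z k : ℝ → C2 r}
    (h : IsSobolev s y g) (h' : IsSobolev s z k) : IsSobolev s (y + z) (g + k) := by
  refine ⟨h.1.add h'.1, fun x hx => ?_⟩
  simp only [Pi.add_apply]
  rw [intervalIntegral.integral_add (intervalIntegrable hs h.1 hx)
    (intervalIntegrable hs h'.1 hx), h.2 x hx, h'.2 x hx]
  abel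

theorem IsSobolev.smul {r : ℕ} {s : ℝ≥0∞} (c : ℂ) {y g : ℝ → C2 r}
    (h : IsSobolev s y g) : IsSobolev s (c • y) (c • g) := by
  refine ⟨h.1.const_smul c, fun x hx => ?_⟩
  simp only [Pi.smul_apply]
  rw [intervalIntegral.integral_smul, h.2 x hx, smul_add]

theorem isSobolev_zero {r : ℕ} {s : ℝ≥0∞} : IsSobolev s (0 : ℝ → C2 r) 0 :=
  ⟨MemLp.zero, fun x _ => by simp⟩

/-- The Sobolev exponent `min(p, 2)`, which is `2` whenever `2 ≤ p`. -/
def sob (p : ℝ≥0∞) : ℝ≥0∞ := min p 2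

theorem one_le_sob {p : ℝ≥0∞} (hp : 1 ≤ p) : 1 ≤ sob p := le_min hp one_le_two

/-- The differential expression `J y' + Q y`, where `g` is the derivative `y'`. -/
def expr {r : ℕ} (q : ℝ → Matrix (Fin r) (Fin r) ℂ) (y g : ℝ → C2 r) (x : ℝ) : C2 r :=
  Matrix.toEuclideanLin (J r) (g x) + Matrix.toEuclideanLin (Q q x) (y x)

/-- The graph of the maximal operator: all pairs `(y, J y' + Q y)` of elements of `L_2`
with `y` in the Sobolev space. -/
def maximalGraph {r : ℕ} (p : ℝ≥0∞) (hp : 1 ≤ p) (q : ℝ → Matrix (Fin r) (Fin r) ℂ) :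
    Submodule ℂ (H r × H r) where
  carrier := {fh | ∃ y g : ℝ → C2 r, IsSobolev (sob p) y g ∧
    fh.1 =ᵐ[mu] y ∧ fh.2 =ᵐ[mu] expr q y g}
  add_mem' := by
    rintro ⟨f, h⟩ ⟨f', h'⟩ ⟨y, g, hs, hf, hh⟩ ⟨y', g', hs', hf', hh'⟩
    refine ⟨y + y', g + g', hs.add (one_le_sob hp) hs', ?_, ?_⟩
    · exact (Lp.coeFn_add f f').trans (hf.add hf')
    · refine (Lp.coeFn_add h h').trans ((hh.add hh').trans (.of_eq ?_))
      funext x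
      simp only [expr, Pi.add_apply, map_add]
      abel
  zero_mem' := by
    refine ⟨0, 0, isSobolev_zero, Lp.coeFn_zero _ _ _, (Lp.coeFn_zero _ _ _).trans (.of_eq ?_)⟩
    funext x
    simp [expr]
  smul_mem' := by
    rintro c ⟨f, h⟩ ⟨y, g, hs, hf, hh⟩
    refine ⟨c • y, c • g, hs.smul c, ?_, ?_⟩
    · exact (Lp.coeFn_smul c f).trans (hf.const_smul c)
    · refine (Lp.coeFn_smul c h).trans ((hh.const_smul c).trans (.of_eq ?_))
      funext x
      simp [expr]

/-- A Sobolev function that vanishes almost everywhere has derivative zero. -/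
theorem IsSobolev.deriv_eq_zero {r : ℕ} {s : ℝ≥0∞} (hs : 1 ≤ s) {y g : ℝ → C2 r}
    (h : IsSobolev s y g) (h0 : y =ᵐ[mu] 0) : g =ᵐ[mu] 0 := by
  have hint := intervalIntegrable hs h.1 (x := 1) (by norm_num)
  have hcont : ContinuousOn y (Icc (-1) 1) := by
    have h1 : ContinuousOn (fun x => ∫ t in (-1 : ℝ)..x, g t) (uIcc (-1) 1) :=
      intervalIntegral.continuousOn_primitive_interval'
        hint left_mem_uIcc
    rw [uIcc_of_le (by norm_num)] at h1
    exact (continuousOn_const.add h1).congr h.2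
  have hz : EqOn y 0 (Ioo (-1) 1) :=
    Measure.eqOn_open_of_ae_eq h0 isOpen_Ioo (hcont.mono Ioo_subset_Icc_self) continuousOn_const
  have hd := hint.ae_hasDerivAt_integral
  unfold mu
  rw [Filter.EventuallyEq, ae_restrict_iff' measurableSet_Ioo]
  filter_upwards [hd] with x hx hxI
  have hxu : x ∈ uIcc (-1 : ℝ) 1 := by
    rw [uIcc_of_le (by norm_num)]; exact Ioo_subset_Icc_self hxI
  have h2 := hx hxu (-1) left_mem_uIcc
  have h3 : HasDerivAt (fun x => ∫ t in (-1 : ℝ)..x, g t) 0 x := by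
    refine (hasDerivAt_const x (-y (-1))).congr_of_eventuallyEq ?_
    filter_upwards [isOpen_Ioo.mem_nhds hxI] with u hu
    have h4 := h.2 u (Ioo_subset_Icc_self hu)
    rw [hz hu] at h4
    exact (neg_eq_of_add_eq_zero_right h4.symm).symm
  exact h2.unique h3

/-- The maximal graph is the graph of an operator. -/
theorem maximalGraph_single_valued {r : ℕ} (p : ℝ≥0∞) (hp : 1 ≤ p)
    (q : ℝ → Matrix (Fin r) (Fin r) ℂ) (x : H r × H r) (hx : x ∈ maximalGraph p hp q)
    (h0 : x.1 = 0) : x.2 = 0 := by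
  obtain ⟨y, g, hs, hf, hh⟩ := hx
  rw [h0] at hf
  have hy : y =ᵐ[mu] 0 := hf.symm.trans (Lp.coeFn_zero _ _ _)
  have hg := hs.deriv_eq_zero (one_le_sob hp) hy
  refine Lp.ext (hh.trans (Filter.EventuallyEq.trans ?_ (Lp.coeFn_zero _ _ _).symm))
  filter_upwards [hy, hg] with t h1 h2
  simp [expr, h1, h2]

/-- The maximal operator `T_q`. -/
def maximal {r : ℕ} (p : ℝ≥0∞) (hp : 1 ≤ p) (q : ℝ → Matrix (Fin r) (Fin r) ℂ) :
    H r →ₗ.[ℂ] H r :=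
  (maximalGraph p hp q).toLinearPMap

theorem maximal_graph {r : ℕ} (p : ℝ≥0∞) (hp : 1 ≤ p) (q : ℝ → Matrix (Fin r) (Fin r) ℂ) :
    (maximal p hp q).graph = maximalGraph p hp q :=
  Submodule.toLinearPMap_graph_eq _ (maximalGraph_single_valued p hp q)

/-- The minimal operator `T_q^0 := T_q^*`. -/
def minimal {r : ℕ} (p : ℝ≥0∞) (hp : 1 ≤ p) (q : ℝ → Matrix (Fin r) (Fin r) ℂ) :
    H r →ₗ.[ℂ] H r :=
  (maximal p hp q).adjoint

/-- The Sobolev functions that satisfy the boundary condition `A y(-1) + B y(1) = 0`. -/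
def boundaryCondition {r : ℕ} (p : ℝ≥0∞) (hp : 1 ≤ p) (A B : M2 r) : Submodule ℂ (H r) where
  carrier := {f | ∃ y g : ℝ → C2 r, IsSobolev (sob p) y g ∧ f =ᵐ[mu] y ∧
    Matrix.toEuclideanLin A (y (-1)) + Matrix.toEuclideanLin B (y 1) = 0}
  add_mem' := by
    rintro f f' ⟨y, g, hs, hf, hb⟩ ⟨y', g', hs', hf', hb'⟩
    refine ⟨y + y', g + g', hs.add (one_le_sob hp) hs',
      (Lp.coeFn_add f f').trans (hf.add hf'), ?_⟩
    simp only [Pi.add_apply, map_add]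
    rw [add_add_add_comm, hb, hb', add_zero]
  zero_mem' := ⟨0, 0, isSobolev_zero, Lp.coeFn_zero _ _ _, by simp⟩
  smul_mem' := by
    rintro c f ⟨y, g, hs, hf, hb⟩
    refine ⟨c • y, c • g, hs.smul c, (Lp.coeFn_smul c f).trans (hf.const_smul c), ?_⟩
    simp only [Pi.smul_apply, map_smul]
    rw [← smul_add, hb, smul_zero]

/-- The projection `P_1 = (I, 0; 0, 0)`. -/
def P1 (r : ℕ) : M2 r := Matrix.fromBlocks 1 0 0 0

/-- The projection `P_2 = (0, 0; 0, I)`. -/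
def P2 (r : ℕ) : M2 r := Matrix.fromBlocks 0 0 0 1

/-- `A_U = P_2 + U P_1`. -/
def AU {r : ℕ} (U : M2 r) : M2 r := P2 r + U * P1 r

/-- `B_U = P_1 + U P_2`. -/
def BU {r : ℕ} (U : M2 r) : M2 r := P1 r + U * P2 r

/-- The restriction `T_{q,U}` of the maximal operator to the functions `y` in its domain with
`A_U y(-1) + B_U y(1) = 0`. -/
def TU {r : ℕ} (p : ℝ≥0∞) (hp : 1 ≤ p) (q : ℝ → Matrix (Fin r) (Fin r) ℂ) (U : M2 r) :
    H r →ₗ.[ℂ] H r :=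
  (maximal p hp q).domRestrict (boundaryCondition p hp (AU U) (BU U))

end

end Dirac

/-! ### Absolutely continuous functions -/

section AbsolutelyContinuous

open Filter

variable {X : Type*} [PseudoMetricSpace X]
variable {F : Type*} [NormedAddCommGroup F]

/-! Since `Q` is Hermitian and `J` is skew-Hermitian, integration by parts reduces ⟨Ty, z⟩ - ⟨y, Tz⟩
to ⟨y(-1), Jz(-1)⟩ - ⟨y(1), Jz(1)⟩. Collect the end point values into i = P₁y(-1) + P₂y(1) and o =
P₂y(-1) + P₁y(1). The boundary form becomes 𝐢(⟨o, o'⟩ - ⟨i, i'⟩), with 𝐢 the imaginary unit, and the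
condition A_U y(-1) + B_U y(1) = 0 becomes o = -Ui. Self-adjoint extensions correspond to subspaces
of boundary values equal to their own annihilator under this form; these are the graphs of
isometries V = -U.

This argument needs that all boundary values occur and that a pair formally adjoint to all elements
with zero boundary values lies in the maximal graph (`IsTraceRelation.exists_trace`,
`IsTraceRelation.exists_of_adjoint`). Both follow by linear algebra from Green's identity and
solvability of the initial value problem (`exists_continuousOn_eq_integral_linear`), where the
coefficients are merely integrable. The classification is `IsBoundaryRelation.isSelfAdjoint`
together with `IsBoundaryRelation.exists_isometry`. -/

theorem AbsolutelyContinuousOnInterval.of_dist_le {f : ℝ → X} {G : ℝ → ℝ} {a b K : ℝ}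
    (hG : AbsolutelyContinuousOnInterval G a b)
    (h : ∀ x ∈ uIcc a b, ∀ y ∈ uIcc a b, dist (f x) (f y) ≤ K * dist (G x) (G y)) :
    AbsolutelyContinuousOnInterval f a b := by
  unfold AbsolutelyContinuousOnInterval at hG ⊢
  apply squeeze_zero' ?_ ?_ (by simpa using Tendsto.const_mul K hG)
  · exact Filter.Eventually.of_forall <| fun _ ↦ Finset.sum_nonneg (fun i hi ↦ dist_nonneg)
  rw [eventually_inf_principal]
  filter_upwards with (n, I) hnI
  simp only [Finset.mul_sum]
  gcongr with i hi
  simp only [AbsolutelyContinuousOnInterval.disjWithin, mem_ofPred_eq] at hnI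
  exact h _ (hnI.left i hi).1 _ (hnI.left i hi).2

theorem IntervalIntegrable.absolutelyContinuousOnInterval_primitive [NormedSpace ℝ F]
    {g : ℝ → F} {a b : ℝ} (hg : IntervalIntegrable g volume a b) :
    AbsolutelyContinuousOnInterval (fun x => ∫ t in a..x, g t) a b := by
  refine AbsolutelyContinuousOnInterval.of_dist_le (K := 1)
    (hg.norm.absolutelyContinuousOnInterval_intervalIntegral (c := a) left_mem_uIcc) ?_
  intro x hx y hy
  have hsub : ∀ z ∈ uIcc a b, IntervalIntegrable g volume a z := fun z hz =>
    hg.mono_set (uIcc_subset_uIcc left_mem_uIcc hz)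
  rw [one_mul, dist_eq_norm, dist_eq_norm,
    intervalIntegral.integral_interval_sub_left (hsub x hx) (hsub y hy),
    intervalIntegral.integral_interval_sub_left (hsub x hx).norm (hsub y hy).norm]
  exact intervalIntegral.norm_integral_le_abs_integral_norm

protected theorem AbsolutelyContinuousOnInterval.inner {F : Type*} [NormedAddCommGroup F]
    [InnerProductSpace ℂ F] {f g : ℝ → F} {a b : ℝ}
    (hf : AbsolutelyContinuousOnInterval f a b) (hg : AbsolutelyContinuousOnInterval g a b) :
    AbsolutelyContinuousOnInterval (fun x => inner ℂ (f x) (g x)) a b := by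
  obtain ⟨C, hC⟩ := hf.exists_bound
  obtain ⟨D, hD⟩ := hg.exists_bound
  unfold AbsolutelyContinuousOnInterval at hf hg ⊢
  apply squeeze_zero' ?_ ?_
    (by simpa using (hg.const_mul C).add (hf.const_mul D))
  · exact Filter.Eventually.of_forall <| fun _ ↦ Finset.sum_nonneg (fun i hi ↦ dist_nonneg)
  rw [eventually_inf_principal]
  filter_upwards with (n, I) hnI
  simp only [Finset.mul_sum, ← Finset.sum_add_distrib]
  gcongr with i hi
  simp only [AbsolutelyContinuousOnInterval.disjWithin, mem_ofPred_eq] at hnI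
  obtain ⟨h1, h2⟩ := hnI.left i hi
  rw [dist_eq_norm, dist_eq_norm, dist_eq_norm]
  -- The product-rule splitting; each increment is paired with a factor bounded by `C` or `D`.
  have : inner ℂ (f (I i).1) (g (I i).1) - inner ℂ (f (I i).2) (g (I i).2) =
      inner ℂ (f (I i).1) (g (I i).1 - g (I i).2) + inner ℂ (f (I i).1 - f (I i).2) (g (I i).2) := by
    rw [inner_sub_right, inner_sub_left]; ring
  rw [this]
  refine (norm_add_le _ _).trans (add_le_add ?_ ?_)
  · exact (norm_inner_le_norm _ _).trans (by gcongr; exact hC _ h1)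
  · rw [mul_comm D]
    exact (norm_inner_le_norm _ _).trans (by gcongr; exact hD _ h2)

/-- Fundamental theorem of calculus for absolutely continuous functions with values in a
Banach space whose derivative exists almost everywhere and is integrable. -/
theorem AbsolutelyContinuousOnInterval.integral_eq_sub_of_ae_hasDerivAt [NormedSpace ℝ F]
    [CompleteSpace F] {f g : ℝ → F} {a b : ℝ} (hf : AbsolutelyContinuousOnInterval f a b)
    (hg : IntervalIntegrable g volume a b)
    (hd : ∀ᵐ x, x ∈ uIcc a b → HasDerivAt f (g x) x) :
    ∫ x in a..b, g x = f b - f a := by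
  -- `f` minus the primitive of `g` is absolutely continuous with derivative zero almost everywhere,
  -- hence constant.
  have hac := hf.sub hg.absolutelyContinuousOnInterval_primitive
  obtain ⟨C, hC⟩ := hac.const_of_ae_hasDerivAt_zero (by
    filter_upwards [hd, hg.ae_hasDerivAt_integral] with x h1 h2 hx
    simpa using (h1 hx).sub (h2 hx a left_mem_uIcc))
  have h1 := hC a left_mem_uIcc
  have h2 := hC b right_mem_uIcc
  simp only [Pi.sub_apply, intervalIntegral.integral_same, sub_zero] at h1 h2
  rw [h1, ← h2]; abel

/-- Integration by parts for the inner product of two absolutely continuous functions. -/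
theorem integral_inner_add_inner_of_primitive {F : Type*} [NormedAddCommGroup F]
    [InnerProductSpace ℂ F] [CompleteSpace F] {y z g k : ℝ → F} {a b : ℝ} (hab : a ≤ b)
    (hg : IntervalIntegrable g volume a b) (hk : IntervalIntegrable k volume a b)
    (hy : ∀ x ∈ Icc a b, y x = y a + ∫ t in a..x, g t)
    (hz : ∀ x ∈ Icc a b, z x = z a + ∫ t in a..x, k t) :
    ∫ x in a..b, (inner ℂ (y x) (k x) + inner ℂ (g x) (z x)) =
      inner ℂ (y b) (z b) - inner ℂ (y a) (z a) := by
  -- `y` and `z` are arbitrary outside `[a, b]`, so they are replaced by primitives defined on all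
  -- of `ℝ`.
  set Y : ℝ → F := fun x => y a + ∫ t in a..x, g t
  set Z : ℝ → F := fun x => z a + ∫ t in a..x, k t
  have hconst : ∀ c : F, AbsolutelyContinuousOnInterval (fun _ : ℝ => c) a b := fun c =>
    (LipschitzWith.const c).lipschitzOnWith.absolutelyContinuousOnInterval
  have hYac : AbsolutelyContinuousOnInterval Y a b :=
    (hconst _).add hg.absolutelyContinuousOnInterval_primitive
  have hZac : AbsolutelyContinuousOnInterval Z a b :=
    (hconst _).add hk.absolutelyContinuousOnInterval_primitive
  have hint : IntervalIntegrable (fun x => inner ℂ (Y x) (k x) + inner ℂ (g x) (Z x))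
      volume a b := by
    have hYc := hYac.continuousOn
    have hZc := hZac.continuousOn
    obtain ⟨C, hC⟩ := hYac.exists_bound
    obtain ⟨D, hD⟩ := hZac.exists_bound
    rw [uIcc_of_le hab] at hYc hZc hC hD
    rw [intervalIntegrable_iff_integrableOn_Ioc_of_le hab] at hg hk ⊢
    have hYm : AEStronglyMeasurable Y (volume.restrict (Ioc a b)) :=
      (hYc.mono Ioc_subset_Icc_self).aestronglyMeasurable measurableSet_Ioc
    have hZm : AEStronglyMeasurable Z (volume.restrict (Ioc a b)) :=
      (hZc.mono Ioc_subset_Icc_self).aestronglyMeasurable measurableSet_Ioc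
    refine Integrable.add ?_ ?_
    · refine (hk.norm.const_mul C).mono' (hYm.inner hk.1) ?_
      filter_upwards [ae_restrict_mem measurableSet_Ioc] with x hx
      exact (norm_inner_le_norm _ _).trans (by gcongr; exact hC x (Ioc_subset_Icc_self hx))
    · refine (hg.norm.mul_const D).mono' (hg.1.inner hZm) ?_
      filter_upwards [ae_restrict_mem measurableSet_Ioc] with x hx
      exact (norm_inner_le_norm _ _).trans (by gcongr; exact hD x (Ioc_subset_Icc_self hx))
  have key := (hYac.inner hZac).integral_eq_sub_of_ae_hasDerivAt hint (by
    filter_upwards [hg.ae_hasDerivAt_integral, hk.ae_hasDerivAt_integral] with x h1 h2 hx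
    exact ((h1 hx a left_mem_uIcc).const_add (y a)).inner ℂ
      ((h2 hx a left_mem_uIcc).const_add (z a)))
  rw [hy b ⟨hab, le_rfl⟩, hz b ⟨hab, le_rfl⟩]
  have e1 : Y a = y a := by simp [Y]
  have e2 : Z a = z a := by simp [Z]
  rw [e1, e2] at key
  rw [← key]
  refine intervalIntegral.integral_congr fun x hx => ?_
  rw [uIcc_of_le hab] at hx
  simp only [hy x hx, hz x hx, Y, Z]

/-- The integrand is half the derivative of exp(2β) with β the primitive of ‖A‖. This computation
produces the contraction constant 1/2 in the existence theorem. -/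
theorem integral_norm_mul_exp_primitive {F : Type*} [NormedAddCommGroup F] {A : ℝ → F} {a b : ℝ}
    (hA : IntervalIntegrable A volume a b) :
    IntervalIntegrable (fun x => ‖A x‖ * Real.exp (2 * ∫ t in a..x, ‖A t‖)) volume a b ∧
    ∫ x in a..b, ‖A x‖ * Real.exp (2 * ∫ t in a..x, ‖A t‖) =
      (Real.exp (2 * ∫ t in a..b, ‖A t‖) - 1) / 2 := by
  have hac : AbsolutelyContinuousOnInterval (fun x => ∫ t in a..x, ‖A t‖) a b :=
    hA.norm.absolutelyContinuousOnInterval_primitive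
  obtain ⟨C, hC⟩ := hac.exists_bound
  have hdiff : ContDiffOn ℝ 1 (fun s : ℝ => Real.exp (2 * s)) (Icc (-C) C) := by
    apply ContDiff.contDiffOn; fun_prop
  obtain ⟨K, hK⟩ := hdiff.exists_lipschitzOnWith (by decide) (convex_Icc _ _) isCompact_Icc
  have hE : AbsolutelyContinuousOnInterval
      (fun x => Real.exp (2 * ∫ t in a..x, ‖A t‖)) a b :=
    AbsolutelyContinuousOnInterval.of_dist_le (K := K) hac fun x hx y hy =>
      hK.dist_le_mul _ (abs_le.1 (hC x hx)) _ (abs_le.1 (hC y hy))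
  have hint : IntervalIntegrable (fun x => ‖A x‖ * Real.exp (2 * ∫ t in a..x, ‖A t‖))
      volume a b := hA.norm.mul_continuousOn hE.continuousOn
  refine ⟨hint, ?_⟩
  have key := hE.integral_eq_sub_of_ae_hasDerivAt (hint.const_mul 2) (by
    filter_upwards [hA.norm.ae_hasDerivAt_integral] with x h1 hx
    have := ((h1 hx a left_mem_uIcc).const_mul 2).exp
    convert! this using 1
    ring)
  rw [intervalIntegral.integral_const_mul] at key
  simp only [intervalIntegral.integral_same, mul_zero, Real.exp_zero] at key
  linarith

end AbsolutelyContinuous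

/-! ### Linear differential equations with integrable coefficients -/

section LinearODE

variable {F : Type*} [NormedAddCommGroup F] [NormedSpace ℝ F]

theorem IntervalIntegrable.clm_apply_continuousOn {A : ℝ → F →L[ℝ] F} {u : ℝ → F} {a b : ℝ}
    (hA : IntervalIntegrable A volume a b) (hu : ContinuousOn u (uIcc a b)) :
    IntervalIntegrable (fun t => A t (u t)) volume a b := by
  obtain ⟨C, hC⟩ := isCompact_uIcc.exists_bound_of_continuousOn hu
  rw [intervalIntegrable_iff] at hA ⊢
  have hum : AEStronglyMeasurable u (volume.restrict (uIoc a b)) :=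
    (hu.mono uIoc_subset_uIcc).aestronglyMeasurable measurableSet_uIoc
  refine (hA.norm.mul_const C).mono'
    ((ContinuousLinearMap.id ℝ (F →L[ℝ] F)).aestronglyMeasurable_comp₂ hA.1 hum) ?_
  filter_upwards [ae_restrict_mem measurableSet_uIoc] with x hx
  exact ((A x).le_opNorm _).trans (by gcongr; exact hC x (uIoc_subset_uIcc hx))

/-- Existence of Carathéodory solutions of `y' = A y + h` with `A` and `h` integrable. -/
theorem exists_continuousOn_eq_integral_linear [CompleteSpace F] {A : ℝ → F →L[ℝ] F} {h : ℝ → F}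
    {a b : ℝ} (hab : a ≤ b) (hA : IntervalIntegrable A volume a b)
    (hh : IntervalIntegrable h volume a b) (c : F) :
    ∃ y : ℝ → F, ContinuousOn y (Icc a b) ∧
      ∀ x ∈ Icc a b, y x = c + ∫ t in a..x, (A t (y t) + h t) := by
  -- Bielecki weight: with y = e^{2β} w, the Picard map for `w` contracts by 1/2 on the whole
  -- interval, so no subdivision is needed.
  set β : ℝ → ℝ := fun x => ∫ t in a..x, ‖A t‖
  have hβ : ContinuousOn β (Icc a b) := by
    have := hA.norm.absolutelyContinuousOnInterval_primitive.continuousOn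
    rwa [uIcc_of_le hab] at this
  set e : ℝ → ℝ := fun x => Real.exp (2 * β x)
  set e' : ℝ → ℝ := fun x => Real.exp (-(2 * β x))
  have he : ContinuousOn e (Icc a b) := by fun_prop
  have he' : ContinuousOn e' (Icc a b) := by fun_prop
  have hee : ∀ x, e x * e' x = 1 := fun x => by simp [e, e', ← Real.exp_add]
  let ext : C(Icc a b, F) → ℝ → F := fun w => IccExtend hab w
  have hext : ∀ w, Continuous (ext w) := fun w => w.continuous.Icc_extend'
  let u : C(Icc a b, F) → ℝ → F := fun w t => e t • ext w t
  have hu : ∀ w, ContinuousOn (u w) (Icc a b) := fun w => he.smul (hext w).continuousOn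
  have hAu : ∀ w, IntervalIntegrable (fun t => A t (u w t)) volume a b := fun w =>
    hA.clm_apply_continuousOn (by rw [uIcc_of_le hab]; exact hu w)
  have hI : ∀ w, IntervalIntegrable (fun t => A t (u w t) + h t) volume a b := fun w =>
    (hAu w).add hh
  let Ψ : C(Icc a b, F) → ℝ → F := fun w x => e' x • (c + ∫ t in a..x, (A t (u w t) + h t))
  have hΨ : ∀ w, ContinuousOn (Ψ w) (Icc a b) := fun w => by
    have := (hI w).absolutelyContinuousOnInterval_primitive.continuousOn
    rw [uIcc_of_le hab] at this
    exact he'.smul (continuousOn_const.add this)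
  let Φ : C(Icc a b, F) → C(Icc a b, F) := fun w => ⟨(Icc a b).domRestrict (Ψ w), (hΨ w).domRestrict⟩
  have hcontr : ContractingWith (1 / 2) Φ := by
    refine ⟨by norm_num [← NNReal.coe_lt_coe], LipschitzWith.of_dist_le_mul fun w v => ?_⟩
    rw [ContinuousMap.dist_le (by positivity)]
    rintro ⟨x, hx⟩
    have hsub : uIcc a x ⊆ uIcc a b := by
      rw [uIcc_of_le hx.1, uIcc_of_le hab]; exact Icc_subset_Icc_right hx.2
    obtain ⟨hi, hv⟩ := integral_norm_mul_exp_primitive (hA.mono_set hsub)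
    have h1 : Ψ w x - Ψ v x = e' x • ∫ t in a..x, A t (u w t - u v t) := by
      simp only [Ψ]
      rw [← smul_sub, add_sub_add_left_eq_sub, ← intervalIntegral.integral_sub
        ((hI w).mono_set hsub) ((hI v).mono_set hsub)]
      simp only [add_sub_add_right_eq_sub, map_sub]
    have h2 : ‖∫ t in a..x, A t (u w t - u v t)‖ ≤
        ∫ t in a..x, dist w v * (‖A t‖ * e t) := by
      refine intervalIntegral.norm_integral_le_of_norm_le hx.1 ?_ (hi.const_mul _)
      refine Filter.Eventually.of_forall fun t ht => ?_
      have : ‖u w t - u v t‖ ≤ e t * dist w v := by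
        simp only [u, ← smul_sub, norm_smul, e, Real.norm_eq_abs, Real.abs_exp]
        gcongr
        rw [← dist_eq_norm]
        exact ContinuousMap.dist_apply_le_dist _
      calc _ ≤ ‖A t‖ * ‖u w t - u v t‖ := (A t).le_opNorm _
        _ ≤ ‖A t‖ * (e t * dist w v) := by gcongr
        _ = _ := by ring
    rw [intervalIntegral.integral_const_mul, hv] at h2
    change dist (Ψ w x) (Ψ v x) ≤ _
    rw [dist_eq_norm, h1, norm_smul, Real.norm_eq_abs, abs_of_pos (Real.exp_pos _)]
    -- Here e'(e - 1)/2 = (1 - e')/2 ≤ 1/2.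
    have h3 : e' x * (dist w v * ((e x - 1) / 2)) ≤ 1 / 2 * dist w v := by
      have h4 := hee x
      have h5 : 0 < e' x := Real.exp_pos _
      have h6 : e' x * (dist w v * ((e x - 1) / 2)) = (e x * e' x - e' x) / 2 * dist w v := by ring
      rw [h6, h4]
      gcongr
      linarith
    push_cast
    exact (mul_le_mul_of_nonneg_left h2 (Real.exp_pos _).le).trans h3
  have hne : Nonempty (C(Icc a b, F)) := ⟨0⟩
  set w := ContractingWith.fixedPoint Φ hcontr
  have hw : Φ w = w := hcontr.fixedPoint_isFixedPt
  refine ⟨u w, hu w, fun x hx => ?_⟩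
  have h1 : ext w x = Ψ w x := by
    have : w ⟨x, hx⟩ = Ψ w x := by
      conv_lhs => rw [← hw]
      rfl
    rw [← this]
    exact IccExtend_of_mem hab _ hx
  simp only [u] at *
  rw [h1]
  simp only [Ψ]
  rw [smul_smul, hee, one_smul]

end LinearODE

/-! ### Trace relations and boundary triples -/

section BoundaryTriple

variable {𝓗 E : Type*} [NormedAddCommGroup 𝓗] [InnerProductSpace ℂ 𝓗]
  [NormedAddCommGroup E] [InnerProductSpace ℂ E]

/-- A relation between elements `(f, h)` of the graph of a first order differential operator on an
interval and the values of `f` at the end points, such that the initial value problem is solvable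
and Green's identity holds for the matrix `J`. -/
structure IsTraceRelation (J : E →ₗ[ℂ] E) (B : Submodule ℂ ((𝓗 × 𝓗) × (E × E))) : Prop where
  exists_solution : ∀ h c, ∃ f d, ((f, h), (c, d)) ∈ B
  trace_eq_zero : ∀ h k, ((0, h), k) ∈ B → k = 0
  green : ∀ x k x' k', (x, k) ∈ B → (x', k') ∈ B →
    inner ℂ x.2 x'.1 - inner ℂ x.1 x'.2 = inner ℂ k.1 (J k'.1) - inner ℂ k.2 (J k'.2)

/-- The relation given by a boundary triple: `k.1` and `k.2` are the abstract incoming and outgoing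
boundary values of `x`, and an element is in the graph of the maximal operator
if it has boundary values. -/
structure IsBoundaryRelation (B : Submodule ℂ ((𝓗 × 𝓗) × (E × E))) : Prop where
  snd_eq_zero : ∀ h k, ((0, h), k) ∈ B → h = 0
  exists_trace : ∀ k, ∃ x, (x, k) ∈ B
  green : ∀ x k x' k', (x, k) ∈ B → (x', k') ∈ B →
    inner ℂ x.2 x'.1 - inner ℂ x.1 x'.2 =
      Complex.I * (inner ℂ k.2 k'.2 - inner ℂ k.1 k'.1)
  exists_of_adjoint : ∀ u : 𝓗 × 𝓗,
    (∀ x, (x, 0) ∈ B → inner ℂ x.2 u.1 = inner ℂ x.1 u.2) → ∃ k, (u, k) ∈ B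

/-! ### Surjectivity of traces and the adjoint, from Green's identity -/

namespace IsTraceRelation

variable {J : E →ₗ[ℂ] E} {B : Submodule ℂ ((𝓗 × 𝓗) × (E × E))}

/-- A linear right inverse of the surjection "initial value" selects homogeneous solutions linearly;
uniqueness of solutions is not needed. -/
theorem exists_homogeneous (hB : IsTraceRelation J B) :
    ∃ (Z : E →ₗ[ℂ] 𝓗) (M : E →ₗ[ℂ] E), ∀ c, ((Z c, 0), (c, M c)) ∈ B := by
  let ι : 𝓗 × E × E →ₗ[ℂ] (𝓗 × 𝓗) × (E × E) :=
    ((LinearMap.fst ℂ 𝓗 (E × E)).prod 0).prod (LinearMap.snd ℂ 𝓗 (E × E))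
  let S : Submodule ℂ (𝓗 × E × E) := B.comap ι
  let π : S →ₗ[ℂ] E := (LinearMap.fst ℂ E E ∘ₗ LinearMap.snd ℂ 𝓗 (E × E)).comp S.subtype
  have hπ : LinearMap.range π = ⊤ := by
    rw [LinearMap.range_eq_top]
    intro c
    obtain ⟨f, d, h⟩ := hB.exists_solution 0 c
    exact ⟨⟨(f, c, d), h⟩, rfl⟩
  obtain ⟨g, hg⟩ := π.exists_rightInverse_of_surjective hπ
  refine ⟨LinearMap.fst ℂ 𝓗 (E × E) ∘ₗ S.subtype ∘ₗ g,
    LinearMap.snd ℂ E E ∘ₗ LinearMap.snd ℂ 𝓗 (E × E) ∘ₗ S.subtype ∘ₗ g, fun c => ?_⟩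
  have h1 : (g c : 𝓗 × E × E).2.1 = c := congrArg (fun f => f c) hg
  have h2 : ι (g c) ∈ B := (g c).2
  have h3 : ι (g c) = (((g c : 𝓗 × E × E).1, 0), ((g c : 𝓗 × E × E).2.1, (g c : 𝓗 × E × E).2.2)) :=
    rfl
  rw [h3, h1] at h2
  exact h2

variable [FiniteDimensional ℂ E]

/-- If `M c = 0`, Green's identity for two homogeneous solutions gives ⟨c, Jc'⟩ = 0 for all c'.
Choosing Jc' = c forces c = 0, and injectivity suffices in finite dimension. -/
theorem surjective_of_homogeneous (hB : IsTraceRelation J B) (hJ : Function.Surjective J)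
    {Z : E →ₗ[ℂ] 𝓗} {M : E →ₗ[ℂ] E} (hZ : ∀ c, ((Z c, 0), (c, M c)) ∈ B) :
    Function.Surjective M := by
  rw [← LinearMap.injective_iff_surjective, ← LinearMap.ker_eq_bot, LinearMap.ker_eq_bot']
  intro c hc
  obtain ⟨c', hc'⟩ := hJ c
  have := hB.green _ _ _ _ (hZ c) (hZ c')
  simp only [inner_zero_left, inner_zero_right, sub_zero, hc, hc'] at this
  exact inner_self_eq_zero.1 this.symm

theorem exists_trace (hB : IsTraceRelation J B) (hJ : Function.Surjective J) (a b : E) :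
    ∃ x, (x, (a, b)) ∈ B := by
  obtain ⟨Z, M, hZ⟩ := hB.exists_homogeneous
  have hM := hB.surjective_of_homogeneous hJ hZ
  -- `R` consists of the final values attainable from initial value zero; it remains to see that it
  -- is everything.
  let ι : (𝓗 × 𝓗) × E →ₗ[ℂ] (𝓗 × 𝓗) × (E × E) :=
    (LinearMap.fst ℂ (𝓗 × 𝓗) E).prod ((0 : _ →ₗ[ℂ] E).prod (LinearMap.snd ℂ (𝓗 × 𝓗) E))
  let R : Submodule ℂ E := (B.comap ι).map (LinearMap.snd ℂ (𝓗 × 𝓗) E)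
  have hR : R = ⊤ := by
    rw [← Submodule.orthogonal_eq_bot_iff, Submodule.eq_bot_iff]
    intro c hc
    obtain ⟨c₁, rfl⟩ := hJ c
    obtain ⟨c', rfl⟩ := hM c₁
    obtain ⟨f, d, hf⟩ := hB.exists_solution (Z c') 0
    -- The source is the homogeneous solution `Z c'` itself, so Green's identity reads ‖Z c'‖² =
    -- -⟨d, JMc'⟩ = 0.
    have hd : d ∈ R := ⟨((f, Z c'), d), hf, rfl⟩
    have h1 := hB.green _ _ _ _ hf (hZ c')
    simp only [inner_zero_left, inner_zero_right, sub_zero,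
      (Submodule.mem_orthogonal _ _).1 hc d hd] at h1
    have h2 := inner_self_eq_zero.1 h1
    have h3 := hZ c'
    rw [h2] at h3
    have h4 : c' = 0 := congrArg Prod.fst (hB.trace_eq_zero _ _ h3)
    simp [h4]
  obtain ⟨⟨x, d⟩, hx, hd⟩ : b - M a ∈ R := hR ▸ Submodule.mem_top
  change d = _ at hd
  subst hd
  refine ⟨x + (Z a, 0), ?_⟩
  convert B.add_mem (show (x, ((0 : E), b - M a)) ∈ B from hx) (hZ a) using 1
  simp

theorem exists_of_adjoint (hB : IsTraceRelation J B) (hJ : Function.Surjective J) (u : 𝓗 × 𝓗)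
    (hu : ∀ x, (x, 0) ∈ B → inner ℂ x.2 u.1 = inner ℂ x.1 u.2) : ∃ k, (u, k) ∈ B := by
  obtain ⟨Z, M, hZ⟩ := hB.exists_homogeneous
  have hM := hB.surjective_of_homogeneous hJ hZ
  obtain ⟨y, d, hy⟩ := hB.exists_solution u.2 0
  -- If h ⊥ range Z, the solution with source h and initial value zero also has final value zero, so
  -- `hu` applies to it; Green's identity with `y` then gives h ⊥ u.1 - y.
  have hmem : u.1 - y ∈ (LinearMap.range Z)ᗮᗮ := by
    rw [Submodule.mem_orthogonal]
    intro h hh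
    obtain ⟨f, d', hf⟩ := hB.exists_solution h 0
    have hd' : d' = 0 := by
      obtain ⟨c₁, hc₁⟩ := hJ d'
      obtain ⟨c', rfl⟩ := hM c₁
      have h1 := hB.green _ _ _ _ hf (hZ c')
      simp only [inner_zero_left, inner_zero_right, sub_zero, zero_sub, hc₁,
        (Submodule.mem_orthogonal' _ _).1 hh (Z c') ⟨c', rfl⟩, zero_eq_neg] at h1
      exact inner_self_eq_zero.1 h1
    subst hd'
    have h1 := hB.green _ _ _ _ hf hy
    have h2 := hu _ hf
    simp only [inner_zero_left, sub_zero] at h1 h2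
    rw [inner_sub_right, h2]
    exact sub_eq_zero.2 (sub_eq_zero.1 h1).symm
  -- The range of `Z` is finite-dimensional, hence equal to its double orthogonal complement.
  rw [Submodule.orthogonal_orthogonal] at hmem
  obtain ⟨c, hc⟩ := hmem
  refine ⟨(0, d) + (c, M c), ?_⟩
  convert B.add_mem hy (hZ c) using 1
  rw [hc]
  ext <;> simp

end IsTraceRelation

/-! ### Self-adjoint extensions in an abstract boundary triple -/

namespace IsBoundaryRelation

variable {B : Submodule ℂ ((𝓗 × 𝓗) × (E × E))} [CompleteSpace 𝓗]

/-- If u is orthogonal to the domain, (0, u) is formally adjoint to all elements with zero boundary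
values, so it lies in the maximal graph, which is single-valued. -/
theorem dense_domain (hB : IsBoundaryRelation B) {T : 𝓗 →ₗ.[ℂ] 𝓗}
    (hT : ∀ x, (x, 0) ∈ B → x ∈ T.graph) : Dense (T.domain : Set 𝓗) := by
  rw [Submodule.dense_iff_topologicalClosure_eq_top, Submodule.topologicalClosure_eq_top_iff,
    Submodule.eq_bot_iff]
  intro u hu
  obtain ⟨k, hk⟩ := hB.exists_of_adjoint (0, u) fun x hx => by
    simp only [inner_zero_right]
    exact ((Submodule.mem_orthogonal _ _).1 hu x.1 (T.mem_domain_of_mem_graph (hT x hx))).symm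
  exact hB.snd_eq_zero _ _ hk

theorem mem_adjoint_graph_iff {T : 𝓗 →ₗ.[ℂ] 𝓗} (hT : Dense (T.domain : Set 𝓗)) {u : 𝓗 × 𝓗} :
    u ∈ T.adjoint.graph ↔ ∀ x ∈ T.graph, inner ℂ x.2 u.1 = inner ℂ x.1 u.2 := by
  rw [LinearPMap.adjoint_graph_eq_graph_adjoint hT, Submodule.mem_adjoint_iff]
  simp only [sub_eq_zero, Prod.forall]

/-- The extension of the minimal operator that is given by an isometry `V` between
boundary values is self-adjoint. -/
theorem isSelfAdjoint (hB : IsBoundaryRelation B) [FiniteDimensional ℂ E]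
    {T : 𝓗 →ₗ.[ℂ] 𝓗} (V : E →ₗᵢ[ℂ] E)
    (hT : ∀ x, x ∈ T.graph ↔ ∃ k, (x, k) ∈ B ∧ k.2 = V k.1) : IsSelfAdjoint T := by
  have hT0 : ∀ x, (x, 0) ∈ B → x ∈ T.graph := fun x hx => (hT x).2 ⟨0, hx, by simp⟩
  have hd := hB.dense_domain hT0
  rw [LinearPMap.isSelfAdjoint_def]
  refine LinearPMap.eq_of_eq_graph (Submodule.ext fun u => ?_)
  rw [mem_adjoint_graph_iff hd]
  constructor
  · intro hu
    obtain ⟨k, hk⟩ := hB.exists_of_adjoint u fun x hx => hu x (hT0 x hx)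
    refine (hT u).2 ⟨k, hk, ?_⟩
    have hV : Function.Surjective V :=
      (LinearMap.injective_iff_surjective (f := V.toLinearMap)).1 V.injective
    -- Testing against boundary values (a, Va) detects k.2 - V k.1, because the vectors Va exhaust
    -- `E`.
    refine ext_inner_left ℂ fun b => ?_
    obtain ⟨a, rfl⟩ := hV b
    obtain ⟨x, hx⟩ := hB.exists_trace (a, V a)
    have h1 := hB.green _ _ _ _ hx hk
    rw [hu x ((hT x).2 ⟨_, hx, rfl⟩), sub_self, eq_comm, mul_eq_zero] at h1
    rw [V.inner_map_map]
    exact sub_eq_zero.1 (h1.resolve_left Complex.I_ne_zero)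
  · intro hu x hx
    obtain ⟨k, hk, hkV⟩ := (hT u).1 hu
    obtain ⟨k', hk', hkV'⟩ := (hT x).1 hx
    have h1 := hB.green _ _ _ _ hk' hk
    rw [hkV, hkV', V.inner_map_map, sub_self, mul_zero] at h1
    exact sub_eq_zero.1 h1

/-- The boundary form is nondegenerate and all boundary values occur, so only zero boundary values
pair trivially with everything. -/
theorem mem_adjoint_maximal (hB : IsBoundaryRelation B)
    {T : 𝓗 →ₗ.[ℂ] 𝓗} (hT : ∀ x, x ∈ T.graph ↔ ∃ k, (x, k) ∈ B) (u : 𝓗 × 𝓗) :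
    u ∈ T.adjoint.graph ↔ (u, 0) ∈ B := by
  have hT0 : ∀ x, (x, 0) ∈ B → x ∈ T.graph := fun x hx => (hT x).2 ⟨0, hx⟩
  rw [mem_adjoint_graph_iff (hB.dense_domain hT0)]
  constructor
  · intro hu
    obtain ⟨k, hk⟩ := hB.exists_of_adjoint u fun x hx => hu x (hT0 x hx)
    have key : ∀ k' : E × E, inner ℂ k'.2 k.2 = inner ℂ k'.1 k.1 := fun k' => by
      obtain ⟨x, hx⟩ := hB.exists_trace k'
      have h1 := hB.green _ _ _ _ hx hk
      rw [hu x ((hT x).2 ⟨_, hx⟩), sub_self, eq_comm, mul_eq_zero] at h1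
      exact sub_eq_zero.1 (h1.resolve_left Complex.I_ne_zero)
    have h2 : k.2 = 0 := by simpa using key (0, k.2)
    have h1 : k.1 = 0 := by simpa using (key (k.1, 0)).symm
    have : k = 0 := Prod.ext h1 h2
    rwa [this] at hk
  · intro hu x hx
    obtain ⟨k, hk⟩ := (hT x).1 hx
    have h1 := hB.green _ _ _ _ hk hu
    simp only [Prod.fst_zero, Prod.snd_zero, inner_zero_right, sub_self, mul_zero] at h1
    exact sub_eq_zero.1 h1

/-- Every self-adjoint extension of the minimal operator is given by an isometry between boundary
values. -/
theorem exists_isometry (hB : IsBoundaryRelation B) [FiniteDimensional ℂ E]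
    {T : 𝓗 →ₗ.[ℂ] 𝓗} (hT : IsSelfAdjoint T) (hT0 : ∀ x, (x, 0) ∈ B → x ∈ T.graph) :
    ∃ V : E →ₗᵢ[ℂ] E, ∀ x, x ∈ T.graph ↔ ∃ k, (x, k) ∈ B ∧ k.2 = V k.1 := by
  have hadj : ∀ u, u ∈ T.graph ↔ ∀ x ∈ T.graph, inner ℂ x.2 u.1 = inner ℂ x.1 u.2 := fun u => by
    rw [← mem_adjoint_graph_iff hT.dense_domain, LinearPMap.isSelfAdjoint_def.1 hT]
  have htr : ∀ u ∈ T.graph, ∃ k, (u, k) ∈ B := fun u hu =>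
    hB.exists_of_adjoint u fun x hx => (hadj u).1 hu x (hT0 x hx)
  have hgraph : ∀ x x' k, x ∈ T.graph → (x, k) ∈ B → (x', k) ∈ B → x' ∈ T.graph := by
    intro x x' k hx h h'
    have h1 : (x' - x, (0 : E × E)) ∈ B := by
      convert B.sub_mem h' h using 1
      simp
    simpa using T.graph.add_mem (hT0 _ h1) hx
  -- `L` is the space of boundary values of `T`. Symmetry makes the form vanish on it (`hiso`), and
  -- self-adjointness makes it maximal with this property (`hmax`).
  let L : Submodule ℂ (E × E) :=
    (B ⊓ T.graph.comap (LinearMap.fst ℂ (𝓗 × 𝓗) (E × E))).map (LinearMap.snd ℂ (𝓗 × 𝓗) (E × E))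
  have hL : ∀ k, k ∈ L ↔ ∃ x ∈ T.graph, (x, k) ∈ B := by
    intro k
    constructor
    · rintro ⟨⟨x, k⟩, ⟨h1, h2⟩, rfl⟩
      exact ⟨x, h2, h1⟩
    · rintro ⟨x, h1, h2⟩
      exact ⟨(x, k), ⟨h2, h1⟩, rfl⟩
  have hiso : ∀ k ∈ L, ∀ k' ∈ L, (inner ℂ k.2 k'.2 : ℂ) = inner ℂ k.1 k'.1 := by
    intro k hk k' hk'
    obtain ⟨x, hx, hxk⟩ := (hL k).1 hk
    obtain ⟨x', hx', hxk'⟩ := (hL k').1 hk'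
    have h1 := hB.green _ _ _ _ hxk hxk'
    rw [(hadj x').1 hx' x hx, sub_self, eq_comm, mul_eq_zero] at h1
    exact sub_eq_zero.1 (h1.resolve_left Complex.I_ne_zero)
  have hmax : ∀ k', (∀ k ∈ L, (inner ℂ k.2 k'.2 : ℂ) = inner ℂ k.1 k'.1) → k' ∈ L := by
    intro k' hk'
    obtain ⟨x', hx'⟩ := hB.exists_trace k'
    refine (hL k').2 ⟨x', (hadj x').2 fun x hx => ?_, hx'⟩
    obtain ⟨k, hk⟩ := htr x hx
    have h1 := hB.green _ _ _ _ hk hx'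
    rw [hk' k ((hL k).2 ⟨x, hx, hk⟩), sub_self, mul_zero] at h1
    exact sub_eq_zero.1 h1
  have hnorm : ∀ k ∈ L, ‖k.2‖ = ‖k.1‖ := by
    intro k hk
    have := hiso k hk k hk
    rw [inner_self_eq_norm_sq_to_K, inner_self_eq_norm_sq_to_K] at this
    have h2 : ‖k.2‖ ^ 2 = ‖k.1‖ ^ 2 := by exact_mod_cast this
    exact (sq_eq_sq₀ (norm_nonneg _) (norm_nonneg _)).1 h2
  let π : L →ₗ[ℂ] E := (LinearMap.fst ℂ E E).comp L.subtype
  have hπ : LinearMap.range π = ⊤ := by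
    rw [← Submodule.orthogonal_eq_bot_iff, Submodule.eq_bot_iff]
    intro a ha
    -- Maximality puts (a, 0) in `L`, where both components have equal norm; hence a = 0.
    have h1 : (a, (0 : E)) ∈ L := hmax _ fun k hk => by
      rw [inner_zero_right]
      exact ((Submodule.mem_orthogonal _ _).1 ha k.1 ⟨⟨k, hk⟩, rfl⟩).symm
    simpa using (hnorm _ h1).symm
  obtain ⟨g, hg⟩ := π.exists_rightInverse_of_surjective hπ
  have hg1 : ∀ a, (g a : E × E).1 = a := fun a => congrArg (fun f => f a) hg
  let V : E →ₗᵢ[ℂ] E :=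
    { toLinearMap := LinearMap.snd ℂ E E ∘ₗ L.subtype ∘ₗ g
      norm_map' := fun a => by
        change ‖(g a : E × E).2‖ = ‖a‖
        rw [hnorm _ (g a).2, hg1] }
  have hV : ∀ k, k ∈ L ↔ k.2 = V k.1 := by
    intro k
    have h1 : (k.1, V k.1) ∈ L := by
      have : (k.1, V k.1) = (g k.1 : E × E) := Prod.ext (hg1 _).symm rfl
      rw [this]
      exact (g k.1).2
    constructor
    · intro hk
      -- The difference has first component zero, so its second component vanishes too.
      have := hnorm _ (L.sub_mem hk h1)
      simpa [sub_eq_zero] using this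
    · intro h
      rwa [← h] at h1
  refine ⟨V, fun x => ⟨fun hx => ?_, ?_⟩⟩
  · obtain ⟨k, hk⟩ := htr x hx
    exact ⟨k, hk, (hV k).1 ((hL k).2 ⟨x, hx, hk⟩)⟩
  · rintro ⟨k, hk, hkV⟩
    obtain ⟨x', hx', hk'⟩ := (hL k).1 ((hV k).2 hkV)
    exact hgraph x' x k hx' hk' hk

end IsBoundaryRelation

end BoundaryTriple

namespace Dirac

noncomputable section

variable {r : ℕ}

instance : IsFiniteMeasure mu := by unfold mu; infer_instance

/-! ### The matrices of the Dirac operator -/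

@[simp] theorem toEuclideanLin_P1_inl (v : C2 r) (i : Fin r) :
    Matrix.toEuclideanLin (P1 r) v (Sum.inl i) = v (Sum.inl i) := by
  simp [P1, Matrix.toLpLin_apply, Matrix.mulVec, dotProduct, Matrix.one_apply]

@[simp] theorem toEuclideanLin_P1_inr (v : C2 r) (i : Fin r) :
    Matrix.toEuclideanLin (P1 r) v (Sum.inr i) = 0 := by
  simp [P1, Matrix.toLpLin_apply, Matrix.mulVec, dotProduct]

@[simp] theorem toEuclideanLin_P2_inl (v : C2 r) (i : Fin r) :
    Matrix.toEuclideanLin (P2 r) v (Sum.inl i) = 0 := by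
  simp [P2, Matrix.toLpLin_apply, Matrix.mulVec, dotProduct]

@[simp] theorem toEuclideanLin_P2_inr (v : C2 r) (i : Fin r) :
    Matrix.toEuclideanLin (P2 r) v (Sum.inr i) = v (Sum.inr i) := by
  simp [P2, Matrix.toLpLin_apply, Matrix.mulVec, dotProduct, Matrix.one_apply]

@[simp] theorem toEuclideanLin_J_inl (v : C2 r) (i : Fin r) :
    Matrix.toEuclideanLin (J r) v (Sum.inl i) = -Complex.I * v (Sum.inl i) := by
  simp [J, Matrix.toLpLin_apply, Matrix.mulVec, dotProduct, Matrix.one_apply]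

@[simp] theorem toEuclideanLin_J_inr (v : C2 r) (i : Fin r) :
    Matrix.toEuclideanLin (J r) v (Sum.inr i) = Complex.I * v (Sum.inr i) := by
  simp [J, Matrix.toLpLin_apply, Matrix.mulVec, dotProduct, Matrix.one_apply]

theorem toEuclideanLin_J_J (v : C2 r) :
    Matrix.toEuclideanLin (J r) (Matrix.toEuclideanLin (J r) v) = -v := by
  ext (i | i) <;> simp [← mul_assoc]

theorem toEuclideanLin_J_surjective : Function.Surjective (Matrix.toEuclideanLin (J r)) :=
  fun v => ⟨-Matrix.toEuclideanLin (J r) v, by rw [map_neg, toEuclideanLin_J_J, neg_neg]⟩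

theorem inner_toEuclideanLin_J_left (v w : C2 r) :
    inner ℂ (Matrix.toEuclideanLin (J r) v) w = -inner ℂ v (Matrix.toEuclideanLin (J r) w) := by
  simp only [PiLp.inner_apply, Fintype.sum_sum_type, toEuclideanLin_J_inl, toEuclideanLin_J_inr,
    RCLike.inner_apply, map_mul, map_neg, Complex.conj_I, neg_add, ← Finset.sum_neg_distrib]
  congr 1 <;> exact Finset.sum_congr rfl fun i _ => by ring

theorem inner_toEuclideanLin_Q_left (q : ℝ → Matrix (Fin r) (Fin r) ℂ) (x : ℝ) (v w : C2 r) :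
    inner ℂ (Matrix.toEuclideanLin (Q q x) v) w = inner ℂ v (Matrix.toEuclideanLin (Q q x) w) := by
  have h : (Q q x)ᴴ = Q q x := by simp [Q, Matrix.fromBlocks_conjTranspose]
  rw [← LinearMap.adjoint_inner_right, ← Matrix.toEuclideanLin_conjTranspose_eq_adjoint, h]

theorem inner_expr_sub_inner_expr (q : ℝ → Matrix (Fin r) (Fin r) ℂ) (y g z k : ℝ → C2 r) (x : ℝ) :
    inner ℂ (expr q y g x) (z x) - inner ℂ (y x) (expr q z k x) =
      -(inner ℂ (y x) (Matrix.toEuclideanLin (J r) (k x)) +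
        inner ℂ (g x) (Matrix.toEuclideanLin (J r) (z x))) := by
  rw [expr, expr, inner_add_left, inner_add_right, inner_toEuclideanLin_J_left,
    inner_toEuclideanLin_Q_left]
  ring

theorem MemQ.memLp_Q {p : ℝ≥0∞} {q : ℝ → Matrix (Fin r) (Fin r) ℂ} (hq : MemQ p q)
    (i j : Fin r ⊕ Fin r) : MemLp (fun x => Q q x i j) p mu := by
  rcases i with i | i <;> rcases j with j | j
  · simp [Q]
  · simpa [Q] using hq i j
  · exact (hq j i).star
  · simp [Q]

/-- Expanding in matrix units transfers integrability of the entries to any normed target, in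
particular to operator norms. -/
theorem MemQ.memLp_map {p : ℝ≥0∞} {q : ℝ → Matrix (Fin r) (Fin r) ℂ} (hq : MemQ p q)
    {W : Type*} [NormedAddCommGroup W] [NormedSpace ℂ W] (Φ : M2 r →ₗ[ℂ] W) :
    MemLp (fun x => Φ (Q q x)) p mu := by
  have h : (fun x => Φ (Q q x)) =
      fun x => ∑ i, ∑ j, Q q x i j • Φ (Matrix.single i j 1) := by
    funext x
    conv_lhs => rw [Matrix.matrix_eq_sum_single (Q q x)]
    simp only [map_sum, ← map_smul, Matrix.smul_single, smul_eq_mul, mul_one]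
  rw [h]
  exact memLp_finsetSum _ fun i _ => memLp_finsetSum _ fun j _ =>
    (memLp_top_const (Φ (Matrix.single i j 1))).smul (hq.memLp_Q i j)

/-! ### Sobolev functions -/

theorem intervalIntegrable_of_memLp {W : Type*} [NormedAddCommGroup W] {s : ℝ≥0∞} (hs : 1 ≤ s)
    {g : ℝ → W} (h : MemLp g s mu) : IntervalIntegrable g volume (-1) 1 := by
  have h1 : IntegrableOn g (Ioo (-1) 1) volume := (h.integrable hs :)
  rwa [intervalIntegrable_iff_integrableOn_Ioo_of_le (by norm_num)]

theorem IsSobolev.continuousOn {s : ℝ≥0∞} (hs : 1 ≤ s) {y g : ℝ → C2 r} (h : IsSobolev s y g) :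
    ContinuousOn y (Icc (-1) 1) := by
  have h1 := (intervalIntegrable_of_memLp hs h.1).absolutelyContinuousOnInterval_primitive.continuousOn
  rw [uIcc_of_le (by norm_num)] at h1
  exact (continuousOn_const.add h1).congr h.2

theorem IsSobolev.eqOn_zero {s : ℝ≥0∞} (hs : 1 ≤ s) {y g : ℝ → C2 r} (h : IsSobolev s y g)
    (h0 : y =ᵐ[mu] 0) : EqOn y 0 (Icc (-1) 1) := by
  have hc := h.continuousOn hs
  have hz : EqOn y 0 (Ioo (-1) 1) :=
    Measure.eqOn_open_of_ae_eq h0 isOpen_Ioo (hc.mono Ioo_subset_Icc_self) continuousOn_const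
  exact hz.of_subset_closure hc continuousOn_const Ioo_subset_Icc_self
    (by rw [closure_Ioo (by norm_num)])

/-- Continuity extends the equality to the end points, so boundary values depend only on the class
in L₂. -/
theorem IsSobolev.eqOn {s : ℝ≥0∞} (hs : 1 ≤ s) {y g z k : ℝ → C2 r} (h : IsSobolev s y g)
    (h' : IsSobolev s z k) (h0 : y =ᵐ[mu] z) : EqOn y z (Icc (-1) 1) := by
  intro x hx
  have := (h.add hs (h'.smul (-1))).eqOn_zero hs
    (h0.mono fun t ht => by simp [ht]) hx
  simpa [← sub_eq_add_neg, sub_eq_zero] using this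

theorem memLp_of_continuousOn {W : Type*} [NormedAddCommGroup W] {y : ℝ → W}
    (hy : ContinuousOn y (Icc (-1) 1)) (s : ℝ≥0∞) : MemLp y s mu := by
  obtain ⟨C, hC⟩ := isCompact_Icc.exists_bound_of_continuousOn hy
  refine MemLp.of_bound
    ((hy.mono Ioo_subset_Icc_self).aestronglyMeasurable measurableSet_Ioo) C ?_
  exact (ae_restrict_mem measurableSet_Ioo).mono fun x hx => hC x (Ioo_subset_Icc_self hx)

/-- The initial value problem `J y' + Q y = h`, `y(-1) = c` has a solution in the Sobolev space. -/
theorem exists_isSobolev_expr_eq {p : ℝ≥0∞} (hp : 1 ≤ p) {q : ℝ → Matrix (Fin r) (Fin r) ℂ}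
    (hq : MemQ p q) (h : H r) (c : C2 r) :
    ∃ y g : ℝ → C2 r, IsSobolev (sob p) y g ∧ (∀ x, expr q y g x = h x) ∧ y (-1) = c := by
  -- As J² = -1, the equation is y' = JQy - Jh; `Φ` sends `M` to the operator `J M`.
  let Φ : M2 r →ₗ[ℂ] (C2 r →L[ℝ] C2 r) :=
    { toFun := fun M => (Matrix.toEuclideanCLM (𝕜 := ℂ) (J r * M)).restrictScalars ℝ
      map_add' := fun M N => by ext1 v; simp [mul_add]
      map_smul' := fun a M => by ext1 v; simp }
  have hΦ : ∀ M v, Φ M v = Matrix.toEuclideanLin (J r) (Matrix.toEuclideanLin M v) := by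
    intro M v
    change Matrix.toEuclideanCLM (𝕜 := ℂ) (J r * M) v = _
    rw [map_mul]
    rfl
  have hA : MemLp (fun x => Φ (Q q x)) p mu := hq.memLp_map Φ
  have hh : MemLp (fun x => -Matrix.toEuclideanLin (J r) (h x)) 2 mu :=
    ((Matrix.toEuclideanCLM (𝕜 := ℂ) (J r)).comp_memLp' (Lp.memLp h)).neg
  obtain ⟨y, hyc, hy⟩ := exists_continuousOn_eq_integral_linear (a := -1) (b := 1) (by norm_num)
    (intervalIntegrable_of_memLp hp hA) (intervalIntegrable_of_memLp one_le_two hh) c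
  have hyc1 : y (-1) = c := by simpa using hy (-1) (by norm_num)
  have hAy : MemLp (fun x => Φ (Q q x) (y x)) p mu := by
    obtain ⟨C, hC⟩ := isCompact_Icc.exists_bound_of_continuousOn hyc
    refine MemLp.of_le_mul (c := C) hA
      ((ContinuousLinearMap.id ℝ (C2 r →L[ℝ] C2 r)).aestronglyMeasurable_comp₂ hA.1
        ((hyc.mono Ioo_subset_Icc_self).aestronglyMeasurable measurableSet_Ioo)) ?_
    refine (ae_restrict_mem measurableSet_Ioo).mono fun x hx => ?_
    rw [mul_comm]
    exact ((Φ (Q q x)).le_opNorm _).trans (by gcongr; exact hC x (Ioo_subset_Icc_self hx))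
  refine ⟨y, fun x => Φ (Q q x) (y x) + -Matrix.toEuclideanLin (J r) (h x), ⟨?_, ?_⟩, ?_, hyc1⟩
  -- JQy is in L_p and Jh in L₂, which is why the Sobolev exponent is min(p, 2).
  · exact (hAy.mono_exponent (min_le_left _ _)).add (hh.mono_exponent (min_le_right _ _))
  · rw [hyc1]
    exact hy
  · intro x
    rw [expr, hΦ, map_add, map_neg, toEuclideanLin_J_J, toEuclideanLin_J_J]
    abel

/-! ### Boundary values -/

/-- The relation between the elements of the graph of the maximal operator and their
values at `-1` and `1`. -/
def traceRelation (p : ℝ≥0∞) (hp : 1 ≤ p) (q : ℝ → Matrix (Fin r) (Fin r) ℂ) :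
    Submodule ℂ ((H r × H r) × (C2 r × C2 r)) where
  carrier := {xk | ∃ y g : ℝ → C2 r, IsSobolev (sob p) y g ∧
    xk.1.1 =ᵐ[mu] y ∧ xk.1.2 =ᵐ[mu] expr q y g ∧ y (-1) = xk.2.1 ∧ y 1 = xk.2.2}
  add_mem' := by
    rintro ⟨⟨f, h⟩, a, b⟩ ⟨⟨f', h'⟩, a', b'⟩ ⟨y, g, hs, hf, hh, rfl, rfl⟩
      ⟨y', g', hs', hf', hh', rfl, rfl⟩
    refine ⟨y + y', g + g', hs.add (one_le_sob hp) hs', ?_, ?_, rfl, rfl⟩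
    · exact (Lp.coeFn_add f f').trans (hf.add hf')
    · refine (Lp.coeFn_add h h').trans ((hh.add hh').trans (.of_eq ?_))
      funext x
      simp only [expr, Pi.add_apply, map_add]
      abel
  zero_mem' := by
    refine ⟨0, 0, isSobolev_zero, Lp.coeFn_zero _ _ _, (Lp.coeFn_zero _ _ _).trans (.of_eq ?_),
      rfl, rfl⟩
    funext x
    simp [expr]
  smul_mem' := by
    rintro c ⟨⟨f, h⟩, a, b⟩ ⟨y, g, hs, hf, hh, rfl, rfl⟩
    refine ⟨c • y, c • g, hs.smul c, ?_, ?_, rfl, rfl⟩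
    · exact (Lp.coeFn_smul c f).trans (hf.const_smul c)
    · refine (Lp.coeFn_smul c h).trans ((hh.const_smul c).trans (.of_eq ?_))
      funext x
      simp [expr]

theorem mem_maximalGraph_iff {p : ℝ≥0∞} (hp : 1 ≤ p) {q : ℝ → Matrix (Fin r) (Fin r) ℂ}
    {x : H r × H r} : x ∈ maximalGraph p hp q ↔ ∃ k, (x, k) ∈ traceRelation p hp q := by
  constructor
  · rintro ⟨y, g, hs, hf, hh⟩
    exact ⟨(y (-1), y 1), y, g, hs, hf, hh, rfl, rfl⟩
  · rintro ⟨k, y, g, hs, hf, hh, -, -⟩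
    exact ⟨y, g, hs, hf, hh⟩

theorem isTraceRelation {p : ℝ≥0∞} (hp : 1 ≤ p) {q : ℝ → Matrix (Fin r) (Fin r) ℂ}
    (hq : MemQ p q) : IsTraceRelation (Matrix.toEuclideanLin (J r)) (traceRelation p hp q) where
  exists_solution h c := by
    obtain ⟨y, g, hs, he, hc⟩ := exists_isSobolev_expr_eq hp hq h c
    have hm := memLp_of_continuousOn (hs.continuousOn (one_le_sob hp)) 2
    exact ⟨hm.toLp, y 1, y, g, hs, hm.coeFn_toLp, .of_eq (funext fun x => (he x).symm), hc, rfl⟩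
  trace_eq_zero := by
    rintro h ⟨a, b⟩ ⟨y, g, hs, hf, -, rfl, rfl⟩
    have := hs.eqOn_zero (one_le_sob hp) (hf.symm.trans (Lp.coeFn_zero _ _ _))
    exact Prod.ext (this (by norm_num)) (this (by norm_num))
  green := by
    rintro ⟨f, h⟩ ⟨a, b⟩ ⟨f', h'⟩ ⟨a', b'⟩ ⟨y, g, hs, hf, hh, rfl, rfl⟩
      ⟨z, k, hs', hf', hh', rfl, rfl⟩
    dsimp only at hf hh hf' hh' ⊢
    have hg := intervalIntegrable_of_memLp (one_le_sob hp) hs.1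
    have hk := intervalIntegrable_of_memLp (one_le_sob hp) hs'.1
    let Jc : C2 r →L[ℂ] C2 r := Matrix.toEuclideanCLM (𝕜 := ℂ) (J r)
    have hkJ : IntervalIntegrable (fun x => Jc (k x)) volume (-1) 1 := by
      have := hk
      rw [intervalIntegrable_iff] at this ⊢
      exact Jc.integrable_comp this
    -- Integration by parts is applied to y and Jz, whose derivative is Jk since `J` is constant.
    have key := integral_inner_add_inner_of_primitive (by norm_num) hg hkJ
      (y := y) (z := fun x => Jc (z x)) hs.2 (fun x hx => by
        rw [hs'.2 x hx, map_add]
        congr 1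
        exact (Jc.intervalIntegral_comp_comm
          (IsSobolev.intervalIntegrable (one_le_sob hp) hs'.1 hx)).symm)
    rw [intervalIntegral.integral_of_le (by norm_num), integral_Ioc_eq_integral_Ioo] at key
    rw [L2.inner_def, L2.inner_def, ← integral_sub (L2.integrable_inner h f')
      (L2.integrable_inner f h')]
    have hae : (fun x => inner ℂ (h x) (f' x) - inner ℂ (f x) (h' x)) =ᵐ[mu] fun x =>
        -(inner ℂ (y x) (Jc (k x)) + inner ℂ (g x) (Jc (z x))) := by
      filter_upwards [hf, hh, hf', hh'] with x h1 h2 h3 h4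
      rw [h1, h2, h3, h4]
      exact inner_expr_sub_inner_expr q y g z k x
    rw [integral_congr_ae hae, integral_neg]
    unfold mu
    rw [key, neg_sub]
    rfl

/-- The pairs `(P₁ i + P₂ o, P₂ i + P₁ o)` of end point values with incoming value `i` and
outgoing value `o`. -/
def endpointValues (r : ℕ) : C2 r × C2 r →ₗ[ℂ] C2 r × C2 r :=
  ((Matrix.toEuclideanLin (P1 r)).coprod (Matrix.toEuclideanLin (P2 r))).prod
    ((Matrix.toEuclideanLin (P2 r)).coprod (Matrix.toEuclideanLin (P1 r)))

theorem endpointValues_apply (k : C2 r × C2 r) : endpointValues r k =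
    (Matrix.toEuclideanLin (P1 r) k.1 + Matrix.toEuclideanLin (P2 r) k.2,
      Matrix.toEuclideanLin (P2 r) k.1 + Matrix.toEuclideanLin (P1 r) k.2) := rfl

theorem endpointValues_surjective : Function.Surjective (endpointValues r) := by
  rintro ⟨a, b⟩
  -- The map is an involution, so the preimage is the image of (a, b).
  refine ⟨(Matrix.toEuclideanLin (P1 r) a + Matrix.toEuclideanLin (P2 r) b,
    Matrix.toEuclideanLin (P2 r) a + Matrix.toEuclideanLin (P1 r) b), ?_⟩
  rw [endpointValues_apply]
  ext (i | i) <;> simp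

/-- The relation between the elements of the graph of the maximal operator and their incoming and
outgoing boundary values. -/
def boundaryRelation (p : ℝ≥0∞) (hp : 1 ≤ p) (q : ℝ → Matrix (Fin r) (Fin r) ℂ) :
    Submodule ℂ ((H r × H r) × (C2 r × C2 r)) :=
  (traceRelation p hp q).comap (LinearMap.id.prodMap (endpointValues r))

theorem mem_boundaryRelation_iff {p : ℝ≥0∞} (hp : 1 ≤ p) {q : ℝ → Matrix (Fin r) (Fin r) ℂ}
    {x : H r × H r} {k : C2 r × C2 r} :
    (x, k) ∈ boundaryRelation p hp q ↔ (x, endpointValues r k) ∈ traceRelation p hp q := Iff.rfl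

theorem mem_maximalGraph_iff_boundaryRelation {p : ℝ≥0∞} (hp : 1 ≤ p)
    {q : ℝ → Matrix (Fin r) (Fin r) ℂ} {x : H r × H r} :
    x ∈ maximalGraph p hp q ↔ ∃ k, (x, k) ∈ boundaryRelation p hp q := by
  rw [mem_maximalGraph_iff]
  constructor
  · rintro ⟨k, hk⟩
    obtain ⟨k', rfl⟩ := endpointValues_surjective k
    exact ⟨k', hk⟩
  · rintro ⟨k, hk⟩
    exact ⟨_, hk⟩

/-- `J` is -𝐢 on the first block and 𝐢 on the second, and the end points enter with opposite signs;
incoming and outgoing values gather the terms of equal sign. -/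
theorem inner_J_endpointValues (k k' : C2 r × C2 r) :
    inner ℂ (endpointValues r k).1 (Matrix.toEuclideanLin (J r) (endpointValues r k').1) -
      inner ℂ (endpointValues r k).2 (Matrix.toEuclideanLin (J r) (endpointValues r k').2) =
    Complex.I * (inner ℂ k.2 k'.2 - inner ℂ k.1 k'.1) := by
  simp only [endpointValues_apply, PiLp.inner_apply, Fintype.sum_sum_type, toEuclideanLin_J_inl,
    toEuclideanLin_J_inr, PiLp.add_apply, toEuclideanLin_P1_inl, toEuclideanLin_P1_inr,
    toEuclideanLin_P2_inl, toEuclideanLin_P2_inr, add_zero, zero_add, RCLike.inner_apply,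
    mul_assoc, ← Finset.mul_sum]
  ring

theorem isBoundaryRelation {p : ℝ≥0∞} (hp : 1 ≤ p) {q : ℝ → Matrix (Fin r) (Fin r) ℂ}
    (hq : MemQ p q) : IsBoundaryRelation (boundaryRelation p hp q) where
  snd_eq_zero h k hk := maximalGraph_single_valued p hp q (0, h)
    ((mem_maximalGraph_iff_boundaryRelation hp).2 ⟨k, hk⟩) rfl
  exists_trace k := (isTraceRelation hp hq).exists_trace toEuclideanLin_J_surjective
    (endpointValues r k).1 (endpointValues r k).2
  green x k x' k' hx hx' := ((isTraceRelation hp hq).green x _ x' _ hx hx').trans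
    (inner_J_endpointValues k k')
  exists_of_adjoint u hu := by
    obtain ⟨k, hk⟩ := (isTraceRelation hp hq).exists_of_adjoint toEuclideanLin_J_surjective u
      fun x hx => hu x (by rwa [mem_boundaryRelation_iff, map_zero])
    obtain ⟨k', rfl⟩ := endpointValues_surjective k
    exact ⟨k', hk⟩

theorem boundaryRelation_unique {p : ℝ≥0∞} (hp : 1 ≤ p) {q : ℝ → Matrix (Fin r) (Fin r) ℂ}
    (hq : MemQ p q) {x : H r × H r} {k k' : C2 r × C2 r}
    (h : (x, k) ∈ boundaryRelation p hp q) (h' : (x, k') ∈ boundaryRelation p hp q) : k = k' := by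
  have h1 : (0, k - k') ∈ boundaryRelation p hp q := by
    simpa using (boundaryRelation p hp q).sub_mem h h'
  have h2 : endpointValues r (k - k') = 0 := (isTraceRelation hp hq).trace_eq_zero 0 _ h1
  have hinj := LinearMap.injective_iff_surjective.2 (endpointValues_surjective (r := r))
  exact sub_eq_zero.1 (hinj (h2.trans (map_zero _).symm))

/-- This is the reason for the form of A_U and B_U: the condition says that the outgoing value is -U
times the incoming one. -/
theorem boundaryCondition_endpointValues (U : M2 r) (k : C2 r × C2 r) :
    Matrix.toEuclideanLin (AU U) (endpointValues r k).1 +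
      Matrix.toEuclideanLin (BU U) (endpointValues r k).2 = k.2 + Matrix.toEuclideanLin U k.1 := by
  have hA : ∀ (M : M2 r) v, Matrix.toEuclideanLin (U * M) v =
      Matrix.toEuclideanLin U (Matrix.toEuclideanLin M v) := fun M v => by
    simp [Matrix.toLpLin_apply]
  rw [AU, BU, map_add, map_add, LinearMap.add_apply, LinearMap.add_apply, hA, hA,
    add_add_add_comm, ← map_add]
  congr 1
  · ext (i | i) <;> simp [endpointValues_apply]
  · congr 1
    ext (i | i) <;> simp [endpointValues_apply]

theorem mem_graph_TU_iff {p : ℝ≥0∞} (hp : 1 ≤ p) {q : ℝ → Matrix (Fin r) (Fin r) ℂ}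
    (U : M2 r) (x : H r × H r) :
    x ∈ (TU p hp q U).graph ↔
      ∃ k, (x, k) ∈ boundaryRelation p hp q ∧ k.2 = -Matrix.toEuclideanLin U k.1 := by
  have h1 : x ∈ (TU p hp q U).graph ↔
      x.1 ∈ boundaryCondition p hp (AU U) (BU U) ∧ x ∈ maximalGraph p hp q := by
    rw [← maximal_graph, LinearPMap.mem_graph_iff, LinearPMap.mem_graph_iff]
    constructor
    · rintro ⟨⟨y, hy1, hy2⟩, hx, hy⟩
      exact ⟨hx ▸ hy1, ⟨y, hy2⟩, hx, hy⟩
    · rintro ⟨h, ⟨y, hy⟩, hx, hy'⟩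
      change y = x.1 at hx
      exact ⟨⟨y, hx.symm ▸ h, hy⟩, hx, hy'⟩
  rw [h1, mem_maximalGraph_iff_boundaryRelation]
  constructor
  · rintro ⟨⟨y, g, hs, hf, hbc⟩, k, hk⟩
    refine ⟨k, hk, ?_⟩
    obtain ⟨z, j, hs', hf', -, ha, hb⟩ := hk
    -- The boundary condition and the boundary relation supply two representatives of the same
    -- class; they agree at the end points.
    have heq := hs.eqOn (one_le_sob hp) hs' (hf.symm.trans hf')
    rw [heq (by norm_num), heq (by norm_num), ha, hb] at hbc
    exact eq_neg_of_add_eq_zero_left ((boundaryCondition_endpointValues U k).symm.trans hbc)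
  · rintro ⟨k, hk, hU⟩
    refine ⟨?_, k, hk⟩
    obtain ⟨z, j, hs', hf', -, ha, hb⟩ := hk
    refine ⟨z, j, hs', hf', ?_⟩
    rw [ha, hb]
    refine (boundaryCondition_endpointValues U k).trans ?_
    rw [hU, neg_add_cancel]

/-! ### Unitary matrices -/

theorem mem_unitaryGroup_iff_inner {n : Type*} [Fintype n] [DecidableEq n] (U : Matrix n n ℂ) :
    U ∈ Matrix.unitaryGroup n ℂ ↔ ∀ v w : EuclideanSpace ℂ n,
      inner ℂ (Matrix.toEuclideanLin U v) (Matrix.toEuclideanLin U w) = inner ℂ v w := by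
  have h : ∀ v w : EuclideanSpace ℂ n,
      inner ℂ (Matrix.toEuclideanLin U v) (Matrix.toEuclideanLin U w) =
      inner ℂ v (Matrix.toEuclideanLin (Uᴴ * U) w) := fun v w => by
    rw [← LinearMap.adjoint_inner_right, ← Matrix.toEuclideanLin_conjTranspose_eq_adjoint]
    simp [Matrix.toLpLin_apply]
  rw [Matrix.mem_unitaryGroup_iff', Matrix.star_eq_conjTranspose]
  simp only [h]
  constructor
  · intro hU v w
    simp [hU]
  · intro hU
    apply Matrix.toEuclideanLin.injective
    ext1 w
    refine ext_inner_left ℂ fun v => ?_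
    rw [hU v w]
    simp

theorem exists_linearIsometry_eq_neg {U : M2 r}
    (hU : U ∈ Matrix.unitaryGroup (Fin r ⊕ Fin r) ℂ) :
    ∃ V : C2 r →ₗᵢ[ℂ] C2 r, ∀ v, V v = -Matrix.toEuclideanLin U v :=
  ⟨(-Matrix.toEuclideanLin U).isometryOfInner fun v w => by
    simpa using (mem_unitaryGroup_iff_inner U).1 hU v w, fun _ => rfl⟩

theorem exists_unitary_of_linearIsometry (V : C2 r →ₗᵢ[ℂ] C2 r) :
    ∃ U : Matrix.unitaryGroup (Fin r ⊕ Fin r) ℂ, ∀ v, V v = -Matrix.toEuclideanLin (U : M2 r) v := by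
  have h : ∀ v, Matrix.toEuclideanLin (Matrix.toEuclideanLin.symm (-V.toLinearMap)) v = -V v :=
    fun v => by simp
  refine ⟨⟨Matrix.toEuclideanLin.symm (-V.toLinearMap), ?_⟩, fun v => ?_⟩
  · rw [mem_unitaryGroup_iff_inner]
    intro v w
    rw [h, h, inner_neg_neg, V.inner_map_map]
  · rw [h, neg_neg]

end

end Dirac

/-! ### Classification of the self-adjoint extensions -/

theorem lemma2p1 (r : ℕ) (p : ℝ≥0∞) (hp : 1 ≤ p) (hp_top : p ≠ ∞)
    (q : ℝ → Matrix (Fin r) (Fin r) ℂ) (hq : Dirac.MemQ p q) :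
    (∀ T : Dirac.H r →ₗ.[ℂ] Dirac.H r,
      (IsSelfAdjoint T ∧ Dirac.minimal p hp q ≤ T) ↔
        ∃ U : Matrix.unitaryGroup (Fin r ⊕ Fin r) ℂ,
          T = Dirac.TU p hp q (U : Matrix (Fin r ⊕ Fin r) (Fin r ⊕ Fin r) ℂ)) ∧
    Function.Injective (fun U : Matrix.unitaryGroup (Fin r ⊕ Fin r) ℂ =>
      Dirac.TU p hp q (U : Matrix (Fin r ⊕ Fin r) (Fin r ⊕ Fin r) ℂ)) := by
  have hB := Dirac.isBoundaryRelation hp hq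
  have hmin : ∀ x, x ∈ (Dirac.minimal p hp q).graph ↔ (x, 0) ∈ Dirac.boundaryRelation p hp q :=
    hB.mem_adjoint_maximal fun x => by
      rw [Dirac.maximal_graph, Dirac.mem_maximalGraph_iff_boundaryRelation]
  refine ⟨fun T => ⟨?_, ?_⟩, fun U V hUV => ?_⟩
  · rintro ⟨hT, hle⟩
    obtain ⟨V, hV⟩ := hB.exists_isometry hT fun x hx =>
      LinearPMap.le_graph_of_le hle ((hmin x).2 hx)
    obtain ⟨U, hU⟩ := Dirac.exists_unitary_of_linearIsometry V
    refine ⟨U, LinearPMap.eq_of_eq_graph (Submodule.ext fun x => ?_)⟩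
    rw [hV, Dirac.mem_graph_TU_iff]
    simp only [hU]
  · rintro ⟨U, rfl⟩
    obtain ⟨V, hV⟩ := Dirac.exists_linearIsometry_eq_neg U.2
    refine ⟨hB.isSelfAdjoint V fun x => ?_, LinearPMap.le_of_le_graph fun x hx => ?_⟩
    · rw [Dirac.mem_graph_TU_iff]
      simp only [hV]
    · exact (Dirac.mem_graph_TU_iff hp _ x).2 ⟨0, (hmin x).1 hx, by simp⟩
  · apply Subtype.ext
    apply Matrix.toEuclideanLin.injective
    ext1 v
    -- Every v occurs as an incoming value; as boundary values are unique, the outgoing value is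
    -- both -Uv and -Vv.
    obtain ⟨x, hx⟩ := hB.exists_trace (v, -Matrix.toEuclideanLin (U : Dirac.M2 r) v)
    have h1 : x ∈ (Dirac.TU p hp q (V : Dirac.M2 r)).graph := by
      have h2 : Dirac.TU p hp q (U : Dirac.M2 r) = Dirac.TU p hp q (V : Dirac.M2 r) := hUV
      exact h2 ▸ (Dirac.mem_graph_TU_iff hp _ x).2 ⟨_, hx, rfl⟩
    obtain ⟨k, hk, hkV⟩ := (Dirac.mem_graph_TU_iff hp _ x).1 h1
    obtain rfl := Dirac.boundaryRelation_unique hp hq hx hk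
    exact neg_injective hkV
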